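/- Let $A$ be a finite alphabet, let $A^+$ be the semigroup of nonempty finite words over $A$ under concatenation, and let $\alpha : A^+ \to S$ be a morphism into a finite semigroup $S$. Write $2^S$ for the semigroup of subsets of $S$ with $T\cdot T' = \{st \mid s\in T,\ t\in T'\}$, and let $\omega\ge 1$ be an integer such that $T^\omega$ is idempotent for every $T \in 2^S$ (the set $T^\omega$ does not depend on the choice of $\omega$). View a word as a structure whose elements are its positions, with the linear order $<$ and a unary predicate for each letter of $A$. Let $\mathrm{FO}$ be the class of languages $\{w\in A^+ \mid w\models\varphi\}$ where $\varphi$ is a first-order sentence over this signature. An $\mathrm{FO}$-partition is a finite partition $\mathbf K$ of $A^+$ into languages of $\mathrm{FO}$; its imprint on $\alpha$ is $$\mathcal I[\alpha](\mathbf K) = \{T\in 2^S \mid T\subseteq \alpha(K) \text{ for some } K\in\mathbf K\}.$$ An $\mathrm{FO}$-partition $\mathbf K$ is optimal for $\alpha$ if $\mathcal I[\alpha](\mathbf K)\subseteq \mathcal I[\alpha](\mathbf K')$ for every $\mathrm{FO}$-partition $\mathbf K'$. All $\mathrm{FO}$-partitions that are optimal for $\alpha$ have the same imprint on $\alpha$,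 which is called the optimal imprint and denoted by $\mathcal I[\alpha]$. Let $\mathrm{Sat}(\alpha)$ be the smallest subset of $2^S$ that contains the singletons $\{\alpha(w)\}$, $w\in A^+$, and is closed under: 1. downset: if $T' \in \mathrm{Sat}(\alpha)$ and $T\subseteq T'$, then $T\in \mathrm{Sat}(\alpha)$; 2. multiplication: if $T,T'\in \mathrm{Sat}(\alpha)$, then $T\cdot T'\in \mathrm{Sat}(\alpha)$; 3. $\mathrm{FO}$-closure: if $T\in \mathrm{Sat}(\alpha)$, then $T^\omega\cup T^{\omega+1}\in \mathrm{Sat}(\alpha)$. Then there exists an $\mathrm{FO}$-partition that is optimal for $\alpha$, and $$\mathcal I[\alpha] = \mathrm{Sat}(\alpha).$$ -/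

import Mathlib

namespace FOImprint

universe u v

open scoped Pointwise

/-! ### First-order logic over finite words -/

/-- The symbols of `FO(<)` over the alphabet `A`: a unary predicate for each letter,
and the binary predicate `<`. -/
inductive WordRel (A : Type u) : ℕ → Type u
  | letter (a : A) : WordRel A 1
  | lt : WordRel A 2

/-- The signature of `FO(<)` over the alphabet `A`. -/
def wordLanguage (A : Type u) : FirstOrder.Language.{0, u} :=
  ⟨fun _ => Empty, WordRel A⟩

/-- The sequence of letters of a nonempty word. -/
def letters {A : Type u} (w : FreeSemigroup A) : List A := w.head :: w.tail

/-- A word `w` as a logical structure: its elements are the positions of `w`, they are labelled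
by letters and linearly ordered. -/
@[reducible]
def wordStructure {A : Type u} (w : FreeSemigroup A) :
    (wordLanguage A).Structure (Fin (letters w).length) where
  funMap := fun f _ => Empty.elim f
  RelMap := fun {_} R =>
    match R with
    | WordRel.letter a => fun x => (letters w).get (x 0) = a
    | WordRel.lt => fun x => x 0 < x 1

/-- The word `w` satisfies the sentence `φ`. -/
def Satisfies {A : Type u} (w : FreeSemigroup A) (φ : (wordLanguage A).Sentence) : Prop :=
  @FirstOrder.Language.Sentence.Realize (wordLanguage A) (Fin (letters w).length)
    (wordStructure w) φ

/-- The class `FO` of first-order definable languages of nonempty words over `A`. -/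
def FO (A : Type u) : Set (Set (FreeSemigroup A)) :=
  {L | ∃ φ : (wordLanguage A).Sentence, L = {w | Satisfies w φ}}

/-! ### Partitions, imprints, optimal imprints -/

/-- A `𝒞`-partition: a finite partition of `A⁺` into languages of the class `𝒞`. -/
structure IsPartitionIn {A : Type u} (𝒞 : Set (Set (FreeSemigroup A)))
    (K : Set (Set (FreeSemigroup A))) : Prop where
  finite : K.Finite
  isPartition : Setoid.IsPartition K
  subset : K ⊆ 𝒞

/-- The imprint on `α` of a family of languages `K`. -/
def imprint {A : Type u} {S : Type v} [Semigroup S] (α : FreeSemigroup A →ₙ* S)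
    (K : Set (Set (FreeSemigroup A))) : Set (Set S) :=
  {T | ∃ L ∈ K, T ⊆ α '' L}

/-- `K` is a `𝒞`-partition that is optimal for `α`. -/
structure IsOptimal {A : Type u} {S : Type v} [Semigroup S]
    (𝒞 : Set (Set (FreeSemigroup A))) (α : FreeSemigroup A →ₙ* S)
    (K : Set (Set (FreeSemigroup A))) : Prop where
  isPartitionIn : IsPartitionIn 𝒞 K
  imprint_subset : ∀ K', IsPartitionIn 𝒞 K' → imprint α K ⊆ imprint α K'

/-- The optimal imprint with respect to `𝒞` on `α`: the imprint on `α` of any `𝒞`-partition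
that is optimal for `α` (see `optimalImprint_eq`). -/
def optimalImprint {A : Type u} {S : Type v} [Semigroup S]
    (𝒞 : Set (Set (FreeSemigroup A))) (α : FreeSemigroup A →ₙ* S) : Set (Set S) :=
  {T | ∃ K, IsOptimal 𝒞 α K ∧ T ∈ imprint α K}

/-- The optimal imprint is the imprint of every optimal partition. -/
theorem optimalImprint_eq {A : Type u} {S : Type v} [Semigroup S]
    {𝒞 : Set (Set (FreeSemigroup A))} {α : FreeSemigroup A →ₙ* S}
    {K : Set (Set (FreeSemigroup A))} (hK : IsOptimal 𝒞 α K) :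
    optimalImprint 𝒞 α = imprint α K := by
  ext T
  constructor
  · rintro ⟨K', hK', hT⟩
    exact hK'.imprint_subset K hK.isPartitionIn hT
  · intro hT
    exact ⟨K, hK, hT⟩

/-! ### The exponent `ω` of a finite semigroup -/

/-- The power `s ^ n`, `n ≥ 1`, in a semigroup. -/
def spow {M : Type v} [Semigroup M] (s : M) (n : ℕ+) : M :=
  PNat.recOn n s fun _ x => x * s

theorem spow_one {M : Type v} [Semigroup M] (s : M) : spow s 1 = s :=
  PNat.recOn_one _ _

theorem spow_succ {M : Type v} [Semigroup M] (s : M) (n : ℕ+) :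
    spow s (n + 1) = spow s n * s :=
  PNat.recOn_succ _ _ _

theorem spow_add {M : Type v} [Semigroup M] (s : M) (m n : ℕ+) :
    spow s (m + n) = spow s m * spow s n := by
  induction n using PNat.recOn with
  | one => rw [spow_succ, spow_one]
  | succ n ih => rw [← add_assoc, spow_succ, spow_succ, ih, mul_assoc]

theorem exists_isIdempotentElem_spow {M : Type v} [Semigroup M] [Finite M] (s : M) :
    ∃ n : ℕ+, IsIdempotentElem (spow s n) := by
  obtain ⟨i, j, hij, h⟩ : ∃ i j : ℕ+, i < j ∧ spow s i = spow s j := by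
    obtain ⟨i, j, hne, h⟩ := Finite.exists_ne_map_eq_of_infinite (fun n : ℕ+ => spow s n)
    rcases lt_or_gt_of_ne hne with hlt | hlt
    · exact ⟨i, j, hlt, h⟩
    · exact ⟨j, i, hlt, h.symm⟩
  obtain ⟨p, rfl⟩ : ∃ p : ℕ+, j = i + p := ⟨j - i, (PNat.add_sub_of_lt hij).symm⟩
  have h1 : ∀ k : ℕ+, spow s (i + k * p) = spow s i := by
    intro k
    induction k using PNat.recOn with
    | one => rw [one_mul, ← h]
    | succ k ih => rw [add_mul, one_mul, ← add_assoc, spow_add, ih, ← spow_add, ← h]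
  refine ⟨i * p, ?_⟩
  unfold IsIdempotentElem
  rw [← spow_add]
  by_cases hp : p = 1
  · subst hp
    simpa using h1 i
  · obtain ⟨q, rfl⟩ : ∃ q : ℕ+, p = q + 1 :=
      ⟨p - 1, by rw [add_comm, PNat.add_sub_of_lt (lt_of_le_of_ne (one_le (a := p)) (Ne.symm hp))]⟩
    have h2 : i * (q + 1) = i * q + i := by ring
    have h3 : i * (q + 1) + i * (q + 1) = i * q + (i + i * (q + 1)) := by ring
    rw [h3, spow_add, h1, ← spow_add, ← h2]

/-- In a finite semigroup there is an exponent `ω ≥ 1` with `s ^ ω` idempotent for all `s`. -/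
theorem exists_omega (M : Type v) [Semigroup M] [Finite M] :
    ∃ n : ℕ+, ∀ s : M, IsIdempotentElem (spow s n) := by
  obtain ⟨n, hn⟩ := exists_isIdempotentElem_spow (M := M → M) id
  have key : ∀ (s : M) (k : ℕ+), spow (id : M → M) k s = spow s k := by
    intro s k
    induction k using PNat.recOn with
    | one => rw [spow_one, spow_one]; rfl
    | succ k ih => rw [spow_succ, spow_succ, ← ih]; rfl
  refine ⟨n, fun s => ?_⟩
  have h := congrFun hn s
  rw [Pi.mul_apply, key] at h
  exact h

/-- The exponent `ω(M)` of a finite semigroup `M`. -/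
noncomputable def omega (M : Type v) [Semigroup M] [Finite M] : ℕ+ :=
  Classical.choose (exists_omega M)

theorem isIdempotentElem_spow_omega {M : Type v} [Semigroup M] [Finite M] (s : M) :
    IsIdempotentElem (spow s (omega M)) :=
  Classical.choose_spec (exists_omega M) s

/-- `s ^ ω` is the only idempotent power of `s`, so it does not depend on the choice of `ω`. -/
theorem spow_eq_spow_omega {M : Type v} [Semigroup M] [Finite M] (s : M) {n : ℕ+}
    (hn : IsIdempotentElem (spow s n)) : spow s n = spow s (omega M) := by
  have key : ∀ m k : ℕ+, IsIdempotentElem (spow s m) → spow s (k * m) = spow s m := by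
    intro m k hm
    induction k using PNat.recOn with
    | one => rw [one_mul]
    | succ k ih => rw [add_mul, one_mul, spow_add, ih, hm]
  rw [← key n (omega M) hn, mul_comm, key _ _ (isIdempotentElem_spow_omega s)]

/-! ### Saturation -/

/-- The downset of a set of subsets of `S`. -/
def downset {S : Type v} (𝒯 : Set (Set S)) : Set (Set S) :=
  {T | ∃ T' ∈ 𝒯, T ⊆ T'}

/-- `𝒯` is closed under downset, multiplication in the semigroup of subsets of `S`, and
`FO`-closure `T ↦ T ^ ω ∪ T ^ (ω + 1)`. Here `T * T'` is `{s * s' | s ∈ T, s' ∈ T'}`, and powers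
and `ω` are those of the semigroup of subsets. -/
structure IsSaturated {S : Type v} [Semigroup S] [Finite S] (𝒯 : Set (Set S)) : Prop where
  downset_eq : 𝒯 = downset 𝒯
  mul_mem : ∀ T ∈ 𝒯, ∀ T' ∈ 𝒯, T * T' ∈ 𝒯
  fo_mem : ∀ T ∈ 𝒯, spow T (omega (Set S)) ∪ spow T (omega (Set S) + 1) ∈ 𝒯

/-- The saturation of `𝒮`: the smallest saturated set that contains `𝒮`. -/
def Sat {S : Type v} [Semigroup S] [Finite S] (𝒮 : Set (Set S)) : Set (Set S) :=
  ⋂₀ {𝒯 | 𝒮 ⊆ 𝒯 ∧ IsSaturated 𝒯}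

theorem isLeast_Sat {S : Type v} [Semigroup S] [Finite S] (𝒮 : Set (Set S)) :
    IsLeast {𝒯 | 𝒮 ⊆ 𝒯 ∧ IsSaturated 𝒯} (Sat 𝒮) := by
  refine ⟨⟨fun T hT 𝒯 h => h.1 hT, ?_, ?_, ?_⟩, fun 𝒯 h T hT => hT 𝒯 h⟩
  · refine Set.Subset.antisymm (fun T hT => ⟨T, hT, subset_rfl⟩) ?_
    rintro T ⟨T', hT', hTT'⟩ 𝒯 h
    rw [h.2.downset_eq]
    exact ⟨T', hT' 𝒯 h, hTT'⟩
  · exact fun T hT T' hT' 𝒯 h => h.2.mul_mem T (hT 𝒯 h) T' (hT' 𝒯 h)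
  · exact fun T hT 𝒯 h => h.2.fo_mem T (hT 𝒯 h)

/-- `Sat(α)`: the saturation of the set of singletons `{α(w)}`, `w ∈ A⁺`. -/
def SatHom {A : Type u} {S : Type v} [Semigroup S] [Finite S] (α : FreeSemigroup A →ₙ* S) :
    Set (Set S) :=
  Sat {T | ∃ w : FreeSemigroup A, T = {α w}}

end FOImprint

namespace FOImprint

universe u v

/-! ### Star-free languages -/

/-! The statement splits into two inclusions: `SatHom α` lies in the imprint of every first-order
partition, and some first-order partition has its imprint inside `SatHom α`. That partition is then
optimal and its imprint equals the saturation.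

Soundness (`SatHom_subset_imprint`). Finitely many first-order languages are saturated by one
congruence `R` on words with a uniform exponent beyond which `w ^ m` and `w ^ (m + 1)` are congruent
(`exists_aperiodicCongruence_of_finite`; formulas are treated by induction, a quantifier being the
marking of one letter). The sets all of whose elements are images of words congruent to one fixed
word form a saturated family: for the FO-closure, a high power of the word serves both `T ^ ω` and
`T ^ (ω + 1)`. Hence each member of the saturation lies in the image of a single block.

Completeness (`exists_partition_imprint_subset`). Inside the subsets of `S¹`, the saturation
together with `{1}` is a finite monoid ordered by inclusion, where `T ^ ω ∪ T ^ (ω + 1)` bounds two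
consecutive powers of `T`. `SharpMonoid` keeps only these properties, and `hasBoundedClassification`
shows that all words over a finite alphabet fall into finitely many star-free classes, each with a
common upper bound for its values. If every letter is a unit, one element bounds all units.
Otherwise words are cut at a letter `b` whose value is not a unit: the `b`-free blocks use a smaller
alphabet, and the sequence of classes of the blocks is a word evaluated in the local divisor at `b`,
a smaller sharp monoid. Star-free languages are first-order definable, and bounds in the saturation
put the imprint inside it by downset closure. -/

/-- The star-free languages of (possibly empty) words over `A`. -/
inductive StarFree {A : Type u} : Set (List A) → Prop
  | nil : StarFree {[]}
  | letter (a : A) : StarFree {[a]}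
  | compl {L : Set (List A)} : StarFree L → StarFree Lᶜ
  | union {L L' : Set (List A)} : StarFree L → StarFree L' → StarFree (L ∪ L')
  | concat {L L' : Set (List A)} : StarFree L → StarFree L' →
      StarFree (Set.image2 (· ++ ·) L L')

namespace StarFree

variable {A : Type u} {L L' : Set (List A)}

theorem univ : StarFree (Set.univ : Set (List A)) := by
  rw [← Set.union_compl_self {[]}]
  exact nil.union nil.compl

theorem empty : StarFree (∅ : Set (List A)) := by
  rw [← Set.compl_univ]
  exact univ.compl

theorem inter (h : StarFree L) (h' : StarFree L') : StarFree (L ∩ L') := by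
  rw [← compl_compl (L ∩ L'), Set.compl_inter]
  exact (h.compl.union h'.compl).compl

theorem biUnion {ι : Type*} {s : Set ι} (hs : s.Finite) {K : ι → Set (List A)}
    (h : ∀ i ∈ s, StarFree (K i)) : StarFree (⋃ i ∈ s, K i) := by
  induction s, hs using Set.Finite.induction_on with
  | empty => simpa using empty
  | insert _ _ ih =>
    rw [Set.biUnion_insert]
    exact (h _ (Set.mem_insert _ _)).union (ih fun i hi => h i (Set.mem_insert_of_mem _ hi))

theorem iInter {ι : Type*} [Finite ι] {K : ι → Set (List A)}
    (h : ∀ i, StarFree (K i)) : StarFree (⋂ i, K i) := by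
  rw [← compl_compl (⋂ i, K i), Set.compl_iInter, ← Set.biUnion_univ]
  exact (biUnion Set.finite_univ fun i _ => (h i).compl).compl

/-- The words without the letter `b`. -/
theorem notMem (b : A) : StarFree {w : List A | b ∉ w} := by
  have : {w : List A | b ∉ w} =
      (Set.image2 (· ++ ·) Set.univ (Set.image2 (· ++ ·) {[b]} Set.univ))ᶜ := by
    ext w
    simp only [Set.mem_ofPred_eq, Set.mem_compl_iff, List.mem_iff_append, Set.mem_image2,
      Set.mem_univ, true_and, Set.mem_singleton_iff, exists_eq_left, List.singleton_append]
    grind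
  rw [this]
  exact (univ.concat ((letter b).concat univ)).compl

end StarFree

/-! ### Words as sequences of blocks that end with a given letter -/

section Blocks

variable {A : Type u} (b : A)

/-- The word `u₁ b u₂ b ⋯ uₙ b`. -/
def joinBlocks : List (List A) → List A
  | [] => []
  | u :: us => u ++ b :: joinBlocks us

theorem joinBlocks_append (us vs : List (List A)) :
    joinBlocks b (us ++ vs) = joinBlocks b us ++ joinBlocks b vs := by
  induction us with
  | nil => rfl
  | cons u us ih => simp [joinBlocks, ih]

theorem append_cons_inj_of_notMem {u u' v v' : List A} (hu : b ∉ u) (hu' : b ∉ u')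
    (h : u ++ b :: v = u' ++ b :: v') : u = u' ∧ v = v' := by
  induction u generalizing u' with
  | nil =>
    cases u' with
    | nil => simpa using h
    | cons c u' => simp at h hu'; exact absurd h.1 hu'.1
  | cons c u ih =>
    cases u' with
    | nil => simp at h hu; exact absurd h.1.symm hu.1
    | cons c' u' =>
      simp only [List.mem_cons, not_or] at hu hu'
      simp only [List.cons_append, List.cons.injEq] at h
      obtain ⟨rfl, rfl⟩ := ih hu.2 hu'.2 h.2
      exact ⟨by rw [h.1], rfl⟩

/-- Uniqueness of the decomposition is what lets `blockPreimage` commute with complements, relative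
to its range. -/
theorem joinBlocks_inj {us vs : List (List A)} (hus : ∀ u ∈ us, b ∉ u) (hvs : ∀ u ∈ vs, b ∉ u)
    (h : joinBlocks b us = joinBlocks b vs) : us = vs := by
  induction us generalizing vs with
  | nil =>
    cases vs with
    | nil => rfl
    | cons v vs => simp [joinBlocks] at h
  | cons u us ih =>
    cases vs with
    | nil => simp [joinBlocks] at h
    | cons v vs =>
      simp only [List.mem_cons, forall_eq_or_imp] at hus hvs
      obtain ⟨rfl, h'⟩ := append_cons_inj_of_notMem b hus.1 hvs.1 h
      rw [ih hus.2 hvs.2 h']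

theorem exists_joinBlocks (w : List A) :
    ∃ (us : List (List A)) (v : List A), (∀ u ∈ us, b ∉ u) ∧ b ∉ v ∧ w = joinBlocks b us ++ v := by
  induction w with
  | nil => exact ⟨[], [], by simp, by simp, rfl⟩
  | cons c w ih =>
    obtain ⟨us, v, hus, hv, rfl⟩ := ih
    by_cases hc : b = c
    · subst hc
      exact ⟨[] :: us, v, by simpa using hus, hv, rfl⟩
    · cases us with
      | nil => exact ⟨[], c :: v, by simp, by simp [hc, hv], rfl⟩
      | cons u us =>
        refine ⟨(c :: u) :: us, v, ?_, hv, rfl⟩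
        simp only [List.mem_cons, forall_eq_or_imp] at hus ⊢
        exact ⟨by simp [hc, hus.1], hus.2⟩

theorem joinBlocks_eq_nil_or (us : List (List A)) :
    joinBlocks b us = [] ∨ ∃ v, joinBlocks b us = v ++ [b] := by
  induction us with
  | nil => exact Or.inl rfl
  | cons u us ih =>
    right
    rcases ih with h | ⟨v, h⟩
    · exact ⟨u, by simp [joinBlocks, h]⟩
    · exact ⟨u ++ b :: v, by simp [joinBlocks, h]⟩

variable {C : Type u} (h : List A → C)

/-- The words `u₁ b ⋯ uₙ b` with `b`-free blocks such that `h u₁ ⋯ h uₙ` belongs to `L`. -/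
def blockPreimage (L : Set (List C)) : Set (List A) :=
  {w | ∃ us : List (List A), (∀ u ∈ us, b ∉ u) ∧ us.map h ∈ L ∧ joinBlocks b us = w}

theorem blockPreimage_univ :
    blockPreimage b h Set.univ = {[]} ∪ Set.image2 (· ++ ·) Set.univ {[b]} := by
  ext w
  constructor
  · rintro ⟨us, -, -, rfl⟩
    rcases joinBlocks_eq_nil_or b us with h | ⟨v, h⟩
    · exact Or.inl h
    · exact Or.inr ⟨v, trivial, [b], rfl, h.symm⟩
  · rintro (rfl | ⟨v, -, _, rfl, rfl⟩)
    · exact ⟨[], by simp, trivial, rfl⟩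
    · obtain ⟨us, v', hus, hv', rfl⟩ := exists_joinBlocks b v
      refine ⟨us ++ [v'], ?_, trivial, ?_⟩
      · intro u hu
        rcases List.mem_append.1 hu with hu | hu
        · exact hus u hu
        · rwa [List.mem_singleton.1 hu]
      · simp [joinBlocks_append, joinBlocks]

/-- Each star-free operation is pulled back separately. Concatenation survives because cutting a
sequence of blocks cuts the word just after a `b`. A complement must be intersected with the words
that are empty or end with `b`. -/
theorem StarFree.blockPreimage {L : Set (List C)} (hL : StarFree L)
    (hh : ∀ c, StarFree (h ⁻¹' {c})) : StarFree (blockPreimage b h L) := by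
  induction hL with
  | nil =>
    have : FOImprint.blockPreimage b h {[]} = {[]} := by
      ext w
      constructor
      · rintro ⟨us, -, hus, rfl⟩
        rw [Set.mem_singleton_iff, List.map_eq_nil_iff] at hus
        rw [hus]; rfl
      · rintro rfl
        exact ⟨[], by simp, rfl, rfl⟩
    rw [this]
    exact nil
  | letter c =>
    have : FOImprint.blockPreimage b h {[c]} =
        Set.image2 (· ++ ·) (h ⁻¹' {c} ∩ {w | b ∉ w}) {[b]} := by
      ext w
      constructor
      · rintro ⟨us, hb, hus, rfl⟩
        rw [Set.mem_singleton_iff, List.map_eq_singleton_iff] at hus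
        obtain ⟨u, rfl, hu⟩ := hus
        exact ⟨u, ⟨hu, hb u (by simp)⟩, [b], rfl, rfl⟩
      · rintro ⟨u, ⟨hu, hb⟩, _, rfl, rfl⟩
        exact ⟨[u], by simpa using hb, by simpa using hu, rfl⟩
    rw [this]
    exact ((hh c).inter (notMem b)).concat (letter b)
  | @compl L _ ih =>
    have : FOImprint.blockPreimage b h Lᶜ =
        FOImprint.blockPreimage b h Set.univ ∩ (FOImprint.blockPreimage b h L)ᶜ := by
      ext w
      constructor
      · rintro ⟨us, hb, hus, rfl⟩
        refine ⟨⟨us, hb, trivial, rfl⟩, ?_⟩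
        rintro ⟨vs, hb', hvs, h'⟩
        rw [joinBlocks_inj b hb' hb h'] at hvs
        exact hus hvs
      · rintro ⟨⟨us, hb, -, rfl⟩, hus⟩
        exact ⟨us, hb, fun hL => hus ⟨us, hb, hL, rfl⟩, rfl⟩
    rw [this, blockPreimage_univ]
    exact (nil.union (univ.concat (letter b))).inter ih.compl
  | @union L L' _ _ ih ih' =>
    have : FOImprint.blockPreimage b h (L ∪ L') =
        FOImprint.blockPreimage b h L ∪ FOImprint.blockPreimage b h L' := by
      ext w
      constructor
      · rintro ⟨us, hb, hus | hus, rfl⟩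
        · exact Or.inl ⟨us, hb, hus, rfl⟩
        · exact Or.inr ⟨us, hb, hus, rfl⟩
      · rintro (⟨us, hb, hus, rfl⟩ | ⟨us, hb, hus, rfl⟩)
        · exact ⟨us, hb, Or.inl hus, rfl⟩
        · exact ⟨us, hb, Or.inr hus, rfl⟩
    rw [this]
    exact ih.union ih'
  | @concat L L' _ _ ih ih' =>
    have : FOImprint.blockPreimage b h (Set.image2 (· ++ ·) L L') =
        Set.image2 (· ++ ·) (FOImprint.blockPreimage b h L)
          (FOImprint.blockPreimage b h L') := by
      ext w
      constructor
      · rintro ⟨us, hb, ⟨x, hx, y, hy, hxy⟩, rfl⟩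
        obtain ⟨vs, vs', rfl, rfl, rfl⟩ := List.map_eq_append_iff.1 hxy.symm
        exact ⟨_, ⟨vs, fun u hu => hb u (by simp [hu]), hx, rfl⟩,
          _, ⟨vs', fun u hu => hb u (by simp [hu]), hy, rfl⟩, (joinBlocks_append b vs vs').symm⟩
      · rintro ⟨_, ⟨vs, hb, hx, rfl⟩, _, ⟨vs', hb', hy, rfl⟩, rfl⟩
        refine ⟨vs ++ vs', ?_, ⟨_, hx, _, hy, by simp⟩, joinBlocks_append b vs vs'⟩
        intro u hu
        exact (List.mem_append.1 hu).elim (hb u) (hb' u)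
    rw [this]
    exact ih.concat ih'

end Blocks

/-! ### Ordered monoids with an upper bound for two consecutive powers -/

/-- An ordered monoid with an operation `sharp` such that `sharp x` is an upper bound of two
consecutive powers of `x`, and that is compatible with conjugation. -/
class SharpMonoid (M : Type v) extends Monoid M, Preorder M where
  mul_le_mul : ∀ {a b c d : M}, a ≤ b → c ≤ d → a * c ≤ b * d
  sharp : M → M
  exists_pow_le_sharp : ∀ x, ∃ n : ℕ, x ^ n ≤ sharp x ∧ x ^ (n + 1) ≤ sharp x
  sharp_mul : ∀ {x b y : M}, x * b = b * y → sharp x * b = b * sharp y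

namespace SharpMonoid

variable {M : Type v} [SharpMonoid M]

/-- Both `g ^ n` and `g ^ (n + 1)` lie below `sharp g`; multiplying by `g⁻¹ ^ n` turns them into `1`
and `g`. -/
theorem exists_one_le_le (g : Mˣ) : ∃ z : M, 1 ≤ z ∧ (g : M) ≤ z := by
  obtain ⟨n, h1, h2⟩ := exists_pow_le_sharp (g : M)
  refine ⟨sharp (g : M) * ((g⁻¹ ^ n : Mˣ) : M), ?_, ?_⟩
  · have := mul_le_mul h1 (le_refl ((g⁻¹ ^ n : Mˣ) : M))
    rwa [← Units.val_pow_eq_pow_val, ← Units.val_mul, inv_pow, mul_inv_cancel,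
      Units.val_one] at this
  · have := mul_le_mul h2 (le_refl ((g⁻¹ ^ n : Mˣ) : M))
    rwa [← Units.val_pow_eq_pow_val, ← Units.val_mul, inv_pow, pow_succ', mul_inv_cancel_right]
      at this

/-- In a finite sharp monoid, the units have a common upper bound. -/
theorem exists_forall_unit_le [Finite M] : ∃ z : M, ∀ g : Mˣ, (g : M) ≤ z := by
  have key : ∀ s : Set Mˣ, s.Finite → ∃ z : M, 1 ≤ z ∧ ∀ g ∈ s, (g : M) ≤ z := by
    intro s hs
    induction s, hs using Set.Finite.induction_on with
    | empty => exact ⟨1, le_rfl, by simp⟩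
    | @insert g s _ _ ih =>
      obtain ⟨z, h1, hz⟩ := ih
      obtain ⟨y, h1y, hy⟩ := exists_one_le_le g
      -- Since both factors dominate `1`, the product dominates whatever either factor dominates.
      refine ⟨y * z, by simpa using mul_le_mul h1y h1, ?_⟩
      rintro g' (rfl | hg')
      · simpa using mul_le_mul hy h1
      · simpa using mul_le_mul h1y (hz g' hg')
  obtain ⟨z, -, hz⟩ := key Set.univ Set.finite_univ
  exact ⟨z, fun g => hz g trivial⟩

/-- The local divisor of `M` at `b`: the set `b M ∩ M b` with the multiplication
`(x b) ∘ (b y) = x b y`. -/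
def LocalDivisor (b : M) : Type v :=
  {u : M // (∃ x, u = x * b) ∧ ∃ y, u = b * y}

namespace LocalDivisor

variable {b : M}

noncomputable instance : Mul (LocalDivisor b) where
  mul u v := ⟨u.2.1.choose * v.1, by
    constructor
    · obtain ⟨x, hx⟩ := v.2.1
      exact ⟨u.2.1.choose * x, by rw [mul_assoc, ← hx]⟩
    · obtain ⟨y, hy⟩ := v.2.2
      obtain ⟨y', hy'⟩ := u.2.2
      refine ⟨y' * y, ?_⟩
      rw [hy, ← mul_assoc, ← u.2.1.choose_spec, ← mul_assoc, ← hy']⟩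

instance : One (LocalDivisor b) where
  one := ⟨b, ⟨1, (one_mul b).symm⟩, ⟨1, (mul_one b).symm⟩⟩

theorem val_one : (1 : LocalDivisor b).1 = b := rfl

/-- The choice of `x` is irrelevant: with `v = b y`, the product is `(x b) y = u y`. -/
theorem val_mul_left {u v : LocalDivisor b} {x : M} (hx : u.1 = x * b) :
    (u * v).1 = x * v.1 := by
  obtain ⟨y, hy⟩ := v.2.2
  change u.2.1.choose * v.1 = x * v.1
  rw [hy, ← mul_assoc, ← mul_assoc, ← hx, ← u.2.1.choose_spec]

theorem val_mul_right {u v : LocalDivisor b} {y : M} (hy : v.1 = b * y) :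
    (u * v).1 = u.1 * y := by
  obtain ⟨x, hx⟩ := u.2.1
  rw [val_mul_left hx, hy, hx, mul_assoc]

noncomputable instance : Monoid (LocalDivisor b) where
  mul_assoc u v w := by
    obtain ⟨x, hx⟩ := u.2.1
    obtain ⟨y, hy⟩ := w.2.2
    apply Subtype.ext
    rw [val_mul_right hy, val_mul_left hx, val_mul_left hx, val_mul_right hy, mul_assoc]
  one_mul u := Subtype.ext (by rw [val_mul_left (x := 1) (by rw [val_one, one_mul]), one_mul])
  mul_one u := Subtype.ext (by rw [val_mul_right (y := 1) (by rw [val_one, mul_one]), mul_one])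

theorem val_pow {u : LocalDivisor b} {x : M} (hx : u.1 = x * b) (n : ℕ) :
    (u ^ n).1 = x ^ n * b := by
  induction n with
  | zero => rw [pow_zero, pow_zero, one_mul, val_one]
  | succ n ih => rw [pow_succ', pow_succ', val_mul_left hx, ih, mul_assoc]

/-- The operation `x b ↦ (sharp x) b`. -/
noncomputable def localSharp (u : LocalDivisor b) : LocalDivisor b :=
  -- The conjugation axiom, applied to `x b = b y`, shows that `sharp x * b` is also `b * sharp y`,
  -- hence again in the local divisor.
  ⟨sharp u.2.1.choose * b, ⟨_, rfl⟩, sharp u.2.2.choose,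
    sharp_mul (u.2.1.choose_spec.symm.trans u.2.2.choose_spec)⟩

theorem val_localSharp_left (u : LocalDivisor b) :
    (localSharp u).1 = sharp u.2.1.choose * b := rfl

theorem val_localSharp_right (u : LocalDivisor b) :
    (localSharp u).1 = b * sharp u.2.2.choose :=
  sharp_mul (u.2.1.choose_spec.symm.trans u.2.2.choose_spec)

noncomputable instance : SharpMonoid (LocalDivisor b) where
  le u v := u.1 ≤ v.1
  le_refl u := le_refl u.1
  le_trans u v w h h' := le_trans (α := M) h h'
  mul_le_mul {u u' v v'} h h' := by
    obtain ⟨x, hx⟩ := u.2.1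
    obtain ⟨y, hy⟩ := v'.2.2
    change (u * v).1 ≤ (u' * v').1
    calc (u * v).1 = x * v.1 := val_mul_left hx
      _ ≤ x * v'.1 := mul_le_mul le_rfl h'
      _ = (u * v').1 := (val_mul_left hx).symm
      _ = u.1 * y := val_mul_right hy
      _ ≤ u'.1 * y := mul_le_mul h le_rfl
      _ = (u' * v').1 := (val_mul_right hy).symm
  sharp := localSharp
  exists_pow_le_sharp u := by
    obtain ⟨n, h1, h2⟩ := exists_pow_le_sharp u.2.1.choose
    refine ⟨n, ?_, ?_⟩
    · change (u ^ n).1 ≤ sharp u.2.1.choose * b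
      rw [val_pow u.2.1.choose_spec]
      exact mul_le_mul h1 le_rfl
    · change (u ^ (n + 1)).1 ≤ sharp u.2.1.choose * b
      rw [val_pow u.2.1.choose_spec]
      exact mul_le_mul h2 le_rfl
  sharp_mul {u c v} h := by
    apply Subtype.ext
    -- With `u = x b` and `v = b y`, the hypothesis `u ∘ c = c ∘ v` reads `x c = c y` in `M`, so the
    -- axiom of `M` applies to `c`.
    rw [val_mul_left (val_localSharp_left u), val_mul_right (val_localSharp_right v)]
    apply sharp_mul
    rw [← val_mul_left u.2.1.choose_spec, ← val_mul_right v.2.2.choose_spec, h]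

instance [Finite M] : Finite (LocalDivisor b) := Subtype.finite

/-- The element `1` is missing: `1 = x b = b y` would make `b` a unit. -/
theorem card_lt [Finite M] (hb : ¬ IsUnit b) : Nat.card (LocalDivisor b) < Nat.card M := by
  apply Finite.card_subtype_lt (x := (1 : M))
  rintro ⟨⟨x, hx⟩, y, hy⟩
  exact hb (isUnit_iff_exists_and_exists.2 ⟨⟨y, hy.symm⟩, x, hx.symm⟩)

end LocalDivisor

end SharpMonoid

/-! ### Star-free classifications with bounded classes -/

open SharpMonoid

/-- The value of a word in a monoid. -/
def wordValue {A : Type u} {M : Type v} [Monoid M] (β : A → M) (w : List A) : M :=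
  (w.map β).prod

section

variable {A : Type u} {M : Type v} [SharpMonoid M] (β : A → M)

theorem wordValue_append (u w : List A) :
    wordValue β (u ++ w) = wordValue β u * wordValue β w := by
  simp [wordValue]

/-- `w ↦ f w` is a classification of the words into finitely many star-free languages, such that
the values of the words of a class that belong to `X` have a common upper bound. -/
def HasBoundedClassification (X : Set (List A)) : Prop :=
  ∃ (ι : Type u) (_ : Finite ι) (f : List A → ι) (T : ι → M),
    (∀ i, StarFree (f ⁻¹' {i})) ∧ ∀ w ∈ X, wordValue β w ≤ T (f w)

variable {β}

/-- A cover may overlap, so a word is classified by the set of all indices whose language contains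
it; any one of them supplies the bound. The default `1` for the empty set of indices is never used
on `X`. -/
theorem hasBoundedClassification_of_cover {X : Set (List A)} {ι : Type u} [Finite ι]
    {K : ι → Set (List A)} (hK : ∀ i, StarFree (K i)) {T : ι → M}
    (hX : ∀ w ∈ X, ∃ i, w ∈ K i) (hT : ∀ i, ∀ w ∈ K i, w ∈ X → wordValue β w ≤ T i) :
    HasBoundedClassification β X := by
  classical
  refine ⟨Set ι, inferInstance, fun w => {i | w ∈ K i},
    fun s => if h : s.Nonempty then T h.some else 1, fun s => ?_, fun w hw => ?_⟩
  · have : (fun w => {i | w ∈ K i}) ⁻¹' {s} = ⋂ i, if i ∈ s then K i else (K i)ᶜ := by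
      ext w
      simp only [Set.mem_preimage, Set.mem_singleton_iff, Set.mem_iInter, Set.ext_iff,
        Set.mem_ofPred_eq]
      refine forall_congr' fun i => ?_
      by_cases hi : i ∈ s <;> simp [hi]
    rw [this]
    refine StarFree.iInter fun i => ?_
    split
    · exact hK i
    · exact (hK i).compl
  · have hne : {i | w ∈ K i}.Nonempty := hX w hw
    simp only [dif_pos hne]
    exact hT _ w hne.some_mem hw

/-- In the local divisor, the product of the elements `b T b` overlaps neighbouring factors `b` and
gives `b T b T b ⋯ T b`. This is why an extra `b` stands in front of the blocks; the empty sequence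
matches the identity `b`. -/
theorem wordValue_block_le {b : A} {X : Set (List A)} {ι : Type u} {f : List A → ι} {T : ι → M}
    (hT : ∀ w ∈ X, wordValue β w ≤ T (f w)) (γ : ι → LocalDivisor (β b))
    (hγ : ∀ i, (γ i).1 = β b * T i * β b) {us : List (List A)} (hus : ∀ u ∈ us, u ∈ X) :
    β b * wordValue β (joinBlocks b us) ≤ (wordValue γ (us.map f)).1 := by
  induction us with
  | nil => simp [joinBlocks, wordValue, LocalDivisor.val_one]
  | cons u us ih =>
    simp only [List.mem_cons, forall_eq_or_imp] at hus
    have h1 : wordValue β (joinBlocks b (u :: us)) =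
        wordValue β u * (β b * wordValue β (joinBlocks b us)) := by
      simp [joinBlocks, wordValue]
    have h2 : wordValue γ ((u :: us).map f) = γ (f u) * wordValue γ (us.map f) := by
      simp [wordValue]
    rw [h1, h2, LocalDivisor.val_mul_left (hγ (f u)), ← mul_assoc]
    exact mul_le_mul (mul_le_mul le_rfl (hT u hus.1)) (ih hus.2)

/-- A word either avoids `b` or is `u b` followed by complete blocks and a `b`-free tail `v`. The
outer parts are classified over `B.erase b`; the middle by its sequence of classes, valued in the
local divisor. The `b` after `u` is the one that `wordValue_block_le` needs. -/
theorem hasBoundedClassification_step [DecidableEq A] {B : Finset A} {b : A}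
    (h : HasBoundedClassification β {w | ∀ a ∈ w, a ∈ B.erase b})
    (h' : ∀ (C : Type u) [Finite C] (γ : C → LocalDivisor (β b)),
      HasBoundedClassification γ Set.univ) :
    HasBoundedClassification β {w | ∀ a ∈ w, a ∈ B} := by
  obtain ⟨ι, _, f, T, hf, hT⟩ := h
  obtain ⟨κ, _, g, V, hg, hV⟩ := h' ι fun i =>
    ⟨β b * T i * β b, ⟨_, rfl⟩, T i * β b, mul_assoc _ _ _⟩
  refine hasBoundedClassification_of_cover (ι := ι ⊕ (ι × κ × ι))
    (K := Sum.elim (fun i => f ⁻¹' {i} ∩ {w | b ∉ w}) fun p =>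
      Set.image2 (· ++ ·) (Set.image2 (· ++ ·) (f ⁻¹' {p.1} ∩ {w | b ∉ w}) {[b]})
        (Set.image2 (· ++ ·) (blockPreimage b f (g ⁻¹' {p.2.1}))
          (f ⁻¹' {p.2.2} ∩ {w | b ∉ w})))
    (T := Sum.elim T fun p => T p.1 * ((V p.2.1).1 * T p.2.2)) ?_ ?_ ?_
  · rintro (i | p)
    · exact (hf i).inter (StarFree.notMem b)
    · exact (((hf _).inter (StarFree.notMem b)).concat (StarFree.letter b)).concat
        (((hg _).blockPreimage b f hf).concat ((hf _).inter (StarFree.notMem b)))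
  · intro w _
    obtain ⟨us, v, hus, hv, rfl⟩ := exists_joinBlocks b w
    cases us with
    | nil => exact ⟨Sum.inl (f v), rfl, hv⟩
    | cons u us =>
      simp only [List.mem_cons, forall_eq_or_imp] at hus
      refine ⟨Sum.inr (f u, g (us.map f), f v), _, ⟨u, ⟨rfl, hus.1⟩, [b], rfl, rfl⟩, _,
        ⟨_, ⟨us, hus.2, rfl, rfl⟩, v, ⟨rfl, hv⟩, rfl⟩, ?_⟩
      simp [joinBlocks]
  · have mem : ∀ {w : List A}, b ∉ w → (∀ a ∈ w, a ∈ B) → ∀ a ∈ w, a ∈ B.erase b :=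
      fun hb hw a ha => Finset.mem_erase.2 ⟨fun hab => hb (hab ▸ ha), hw a ha⟩
    rintro (i | ⟨i, k, j⟩)
    · rintro w ⟨rfl, hb⟩ hw
      exact hT w (mem hb hw)
    · rintro _ ⟨_, ⟨u, ⟨rfl, hu⟩, _, rfl, rfl⟩, _, ⟨_, ⟨us, hus, rfl, rfl⟩, v, ⟨rfl, hv⟩, rfl⟩, rfl⟩
        hw
      have hsub : ∀ {us : List (List A)} {u : List A}, u ∈ us → ∀ {a}, a ∈ u →
          a ∈ joinBlocks b us := by
        intro us u hu a ha
        induction us with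
        | nil => simp at hu
        | cons u' us ih =>
          rcases List.mem_cons.1 hu with rfl | hu
          · simp [joinBlocks, ha]
          · simp [joinBlocks, ih hu]
      simp only [Set.mem_ofPred_eq, List.mem_append] at hw
      simp only [wordValue_append, Sum.elim_inr, mul_assoc]
      refine mul_le_mul (hT u (mem hu fun a ha => hw a (by simp [ha]))) ?_
      rw [← mul_assoc]
      refine mul_le_mul ?_ (hT v (mem hv fun a ha => hw a (by simp [ha])))
      have h1 : wordValue β [b] = β b := by simp [wordValue]
      rw [h1]
      refine le_trans (wordValue_block_le (X := {w | ∀ a ∈ w, a ∈ B.erase b}) hT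
        (fun i => ⟨β b * T i * β b, ⟨_, rfl⟩, T i * β b, mul_assoc _ _ _⟩) (fun i => rfl) ?_)
        (hV (us.map f) trivial)
      exact fun u hu => mem (hus u hu) fun a ha => hw a (by simp [hsub hu ha])

end

/-- The outer induction, on the size of the monoid, must allow every finite alphabet, since the
local divisor is used with classes as letters. The inner induction removes letters with non-unit
value. -/
theorem hasBoundedClassification (n : ℕ) : ∀ {M : Type v} [SharpMonoid M] [Finite M],
    Nat.card M = n → ∀ (A : Type u) [Finite A] (β : A → M),
    HasBoundedClassification β Set.univ := by
  induction n using Nat.strong_induction_on with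
  | _ n ih =>
    intro M _ _ hM A _ β
    classical
    have key : ∀ B : Finset A, HasBoundedClassification β {w | ∀ a ∈ w, a ∈ B} := by
      intro B
      induction B using Finset.strongInduction with
      | H B ihB =>
        by_cases hB : ∃ b ∈ B, ¬ IsUnit (β b)
        · obtain ⟨b, hb, hunit⟩ := hB
          exact hasBoundedClassification_step (ihB _ (Finset.erase_ssubset hb))
            fun C _ γ => ih _ (hM ▸ LocalDivisor.card_lt hunit) rfl C γ
        · push Not at hB
          obtain ⟨z, hz⟩ := exists_forall_unit_le (M := M)
          refine hasBoundedClassification_of_cover (ι := PUnit) (K := fun _ => Set.univ)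
            (T := fun _ => z) (fun _ => StarFree.univ) (fun w _ => ⟨⟨⟩, trivial⟩) ?_
          intro _ w _ hw
          have hu : IsUnit (wordValue β w) := by
            induction w with
            | nil => exact isUnit_one
            | cons a w ihw =>
              have : wordValue β (a :: w) = β a * wordValue β w := by simp [wordValue]
              rw [this]
              exact (hB a (hw a (by simp))).mul (ihw trivial fun a ha => hw a (by simp [ha]))
          obtain ⟨g, hg⟩ := hu
          exact hg ▸ hz g
    have := Fintype.ofFinite A
    simpa [Set.ofPred_true] using key Finset.univ

/-! ### Definability of predicates on words with distinguished positions -/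

open FirstOrder

/-- A finite word as a structure. -/
@[reducible]
def listStructure {A : Type u} (l : List A) : (wordLanguage A).Structure (Fin l.length) where
  funMap := fun f _ => Empty.elim f
  RelMap := fun {_} R =>
    match R with
    | WordRel.letter a => fun x => l.get (x 0) = a
    | WordRel.lt => fun x => x 0 < x 1

/-- Satisfaction of a formula in a word with distinguished positions. -/
def Holds {A : Type u} {n : ℕ} (φ : (wordLanguage A).BoundedFormula Empty n) (l : List A)
    (x : Fin n → Fin l.length) : Prop :=
  letI := listStructure l
  φ.Realize default x

/-- A property of words with `n` distinguished positions that is defined by a first-order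
formula. -/
def Definable {A : Type u} {n : ℕ} (P : (l : List A) → (Fin n → Fin l.length) → Prop) : Prop :=
  ∃ φ : (wordLanguage A).BoundedFormula Empty n, ∀ l x, Holds φ l x ↔ P l x

namespace Definable

variable {A : Type u} {n : ℕ} {P Q : (l : List A) → (Fin n → Fin l.length) → Prop}

theorem congr (hP : Definable P) (h : ∀ l x, P l x ↔ Q l x) : Definable Q := by
  obtain ⟨φ, hφ⟩ := hP
  exact ⟨φ, fun l x => (hφ l x).trans (h l x)⟩

theorem false : Definable (fun (l : List A) (_ : Fin n → Fin l.length) => False) :=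
  ⟨⊥, fun _ _ => Iff.rfl⟩

theorem not (hP : Definable P) : Definable (fun l x => ¬ P l x) := by
  obtain ⟨φ, hφ⟩ := hP
  exact ⟨φ.not, fun l x => not_congr (hφ l x)⟩

theorem true : Definable (fun (l : List A) (_ : Fin n → Fin l.length) => True) :=
  false.not.congr fun _ _ => not_false_iff

theorem or (hP : Definable P) (hQ : Definable Q) : Definable (fun l x => P l x ∨ Q l x) := by
  obtain ⟨φ, hφ⟩ := hP
  obtain ⟨ψ, hψ⟩ := hQ
  refine ⟨φ ⊔ ψ, fun l x => ?_⟩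
  let _ := listStructure l
  exact Language.BoundedFormula.realize_sup.trans (or_congr (hφ l x) (hψ l x))

theorem and (hP : Definable P) (hQ : Definable Q) : Definable (fun l x => P l x ∧ Q l x) := by
  obtain ⟨φ, hφ⟩ := hP
  obtain ⟨ψ, hψ⟩ := hQ
  refine ⟨φ ⊓ ψ, fun l x => ?_⟩
  let _ := listStructure l
  exact Language.BoundedFormula.realize_inf.trans (and_congr (hφ l x) (hψ l x))

theorem ex {P : (l : List A) → (Fin (n + 1) → Fin l.length) → Prop} (hP : Definable P) :
    Definable (fun (l : List A) (x : Fin n → Fin l.length) =>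
      ∃ p : Fin l.length, P l (Fin.snoc x p)) := by
  obtain ⟨φ, hφ⟩ := hP
  refine ⟨φ.ex, fun l x => ?_⟩
  let _ := listStructure l
  exact Language.BoundedFormula.realize_ex.trans (exists_congr fun p => hφ l _)

theorem lt (i j : Fin n) :
    Definable (fun (l : List A) (x : Fin n → Fin l.length) => x i < x j) :=
  ⟨.rel (l := 2) WordRel.lt ![.var (.inr i), .var (.inr j)], fun _ _ => Iff.rfl⟩

theorem letter (i : Fin n) (a : A) :
    Definable (fun (l : List A) (x : Fin n → Fin l.length) => l.get (x i) = a) :=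
  ⟨.rel (l := 1) (WordRel.letter a) ![.var (.inr i)], fun _ _ => Iff.rfl⟩

end Definable

/-- The cut of a word before the first letter, or just after a distinguished position. -/
def cut {m n : ℕ} (x : Fin n → Fin m) : Option (Fin n) → ℕ
  | none => 0
  | some i => x i + 1

theorem cut_le {m n : ℕ} (x : Fin n → Fin m) (c : Option (Fin n)) : cut x c ≤ m := by
  cases c with
  | none => exact Nat.zero_le _
  | some i => exact (x i).2

theorem cut_snoc_castSucc {m n : ℕ} (x : Fin n → Fin m) (p : Fin m) (c : Option (Fin n)) :
    cut (Fin.snoc x p : Fin (n + 1) → Fin m) (c.map Fin.castSucc) = cut x c := by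
  cases c <;> simp [cut]

theorem cut_snoc_last {m n : ℕ} (x : Fin n → Fin m) (p : Fin m) :
    cut (Fin.snoc x p : Fin (n + 1) → Fin m) (some (Fin.last n)) = p + 1 := by
  simp [cut]

theorem Definable.cut_lt {A : Type u} {n : ℕ} (c d : Option (Fin n)) :
    Definable (fun (l : List A) (x : Fin n → Fin l.length) => cut x c < cut x d) := by
  cases d with
  | none => exact Definable.false.congr fun l x => by simp [cut]
  | some j =>
    cases c with
    | none => exact Definable.true.congr fun l x => by simp [cut]
    | some i => exact (Definable.lt i j).congr fun l x => by simp [cut]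

/-- The factor between two cuts. -/
def factor {A : Type u} (l : List A) (c d : ℕ) : List A := (l.take d).drop c

theorem factor_eq_nil {A : Type u} {l : List A} {c d : ℕ} (hd : d ≤ l.length) :
    factor l c d = [] ↔ ¬ c < d := by
  rw [factor, List.drop_eq_nil_iff, List.length_take]
  omega

theorem factor_append_factor {A : Type u} {l : List A} {c e d : ℕ} (hce : c ≤ e) (hed : e ≤ d) :
    factor l c e ++ factor l e d = factor l c d := by
  simp only [factor, List.drop_take]
  conv_rhs => rw [show d - c = (e - c) + (d - e) by omega, List.take_add, List.drop_drop]
  rw [Nat.add_sub_cancel' hce]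

theorem factor_eq_append {A : Type u} {l u v : List A} {c d : ℕ} (hd : d ≤ l.length)
    (h : factor l c d = u ++ v) (hcd : c ≤ d) :
    factor l c (c + u.length) = u ∧ factor l (c + u.length) d = v ∧ c + u.length ≤ d := by
  have hlen : u.length + v.length = d - c := by
    rw [← List.length_append, ← h, factor, List.length_drop, List.length_take]
    omega
  have hle : c + u.length ≤ d := by omega
  have h' := (factor_append_factor (l := l) (Nat.le_add_right c u.length) hle).trans h
  have hl : (factor l c (c + u.length)).length = u.length := by
    rw [factor, List.length_drop, List.length_take]
    omega
  obtain ⟨h1, h2⟩ := List.append_inj h' hl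
  exact ⟨h1, h2, hle⟩

theorem factor_eq_singleton {A : Type u} {l : List A} {c d : ℕ} {a : A} (hd : d ≤ l.length) :
    factor l c d = [a] ↔ d = c + 1 ∧ ∃ h : c < l.length, l[c]'h = a := by
  have key : ∀ h : c < l.length, factor l c (c + 1) = [l[c]'h] := by
    intro h
    rw [factor, List.drop_take, Nat.add_sub_cancel_left, List.drop_eq_getElem_cons h,
      List.take_succ_cons, List.take_zero]
  constructor
  · intro h
    have hlen := congrArg List.length h
    simp only [factor, List.length_drop, List.length_take, List.length_singleton] at hlen
    have hc : c < l.length := by omega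
    obtain rfl : d = c + 1 := by omega
    have h' := (key hc).symm.trans h
    rw [List.cons.injEq] at h'
    exact ⟨rfl, hc, h'.1⟩
  · rintro ⟨rfl, h, rfl⟩
    exact key h

/-- Relativizing to factors makes the induction work: a concatenation is an existential
quantification over an intermediate cut, so cuts must be arbitrary variables. -/
theorem StarFree.definable_factor {A : Type u} {L : Set (List A)} (hL : StarFree L) :
    ∀ (n : ℕ) (c d : Option (Fin n)), Definable
      (fun (l : List A) (x : Fin n → Fin l.length) => factor l (cut x c) (cut x d) ∈ L) := by
  induction hL with
  | nil =>
    intro n c d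
    exact (Definable.cut_lt c d).not.congr fun l x => (factor_eq_nil (cut_le x d)).symm
  | letter a =>
    intro n c d
    -- No cut lies strictly between the two given ones, so the factor has at most one letter.
    have h1 := (((Definable.cut_lt (A := A) (c.map Fin.castSucc) (some (Fin.last n))).and
      (Definable.cut_lt (some (Fin.last n)) (d.map Fin.castSucc))).ex).not
    cases d with
    | none =>
      exact Definable.false.congr fun l x => by
        simp [Set.mem_singleton_iff, factor_eq_singleton, cut]
    | some j =>
      refine (((Definable.cut_lt c (some j)).and h1).and (Definable.letter j a)).congr
        fun l x => ?_
      simp only [Set.mem_singleton_iff, factor_eq_singleton (cut_le x _), cut_snoc_last,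
        cut_snoc_castSucc, not_exists]
      constructor
      · rintro ⟨⟨h1, h2⟩, h3⟩
        have h4 : cut x c = x j := by
          by_contra hne
          simp only [cut] at h1 h2
          have := h2 ⟨cut x c, by have := (x j).2; simp only [cut]; omega⟩
          simp only [cut] at this hne
          omega
        refine ⟨by rw [h4]; rfl, by rw [h4]; exact (x j).2, ?_⟩
        simpa [h4] using h3
      · rintro ⟨h1, h2, h3⟩
        have h4 : cut x c = x j := by simpa [cut] using h1.symm
        refine ⟨⟨by omega, fun p => by omega⟩, ?_⟩
        simpa [h4] using h3
  | compl _ ih => exact fun n c d => (ih n c d).not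
  | union _ _ ih ih' => exact fun n c d => (ih n c d).or (ih' n c d)
  | @concat L L' _ _ ih ih' =>
    intro n c d
    -- The first alternative handles an empty left factor: the cut then coincides with `c`, which
    -- may be the start of the word and so not given by a position. Otherwise the cut follows the
    -- last letter of the left factor.
    refine (((ih n c c).and (ih' n c d)).or
      ((((Definable.cut_lt (c.map Fin.castSucc) (some (Fin.last n))).and
        (Definable.cut_lt (d.map Fin.castSucc) (some (Fin.last n))).not).and
        ((ih (n + 1) (c.map Fin.castSucc) (some (Fin.last n))).and
          (ih' (n + 1) (some (Fin.last n)) (d.map Fin.castSucc)))).ex)).congr fun l x => ?_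
    simp only [cut_snoc_castSucc, cut_snoc_last]
    constructor
    · rintro (⟨h1, h2⟩ | ⟨p, ⟨h1, h2⟩, h3, h4⟩)
      · refine ⟨_, h1, _, h2, ?_⟩
        rw [(factor_eq_nil (cut_le x c)).2 (lt_irrefl _)]
        rfl
      · exact ⟨_, h3, _, h4, factor_append_factor h1.le (not_lt.1 h2)⟩
    · rintro ⟨u, hu, v, hv, huv⟩
      rcases eq_or_ne u [] with rfl | hne
      · left
        rw [(factor_eq_nil (cut_le x c)).2 (lt_irrefl _), ← huv]
        exact ⟨hu, hv⟩
      · right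
        have hcd : cut x c ≤ cut x d := by
          by_contra hcd
          rw [(factor_eq_nil (cut_le x d)).2 (by omega)] at huv
          exact hne (List.append_eq_nil_iff.1 huv).1
        obtain ⟨h1, h2, h3⟩ := factor_eq_append (cut_le x d) huv.symm hcd
        have hpos := List.length_pos_iff.2 hne
        have hd := cut_le x d
        refine ⟨⟨cut x c + u.length - 1, by omega⟩, ?_⟩
        rw [show cut x c + u.length - 1 + 1 = cut x c + u.length by omega, h1, h2]
        exact ⟨⟨by omega, by omega⟩, hu, hv⟩

/-- Star-free languages are first-order definable. -/
theorem StarFree.letters_preimage_mem_FO {A : Type u} {L : Set (List A)} (hL : StarFree L) :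
    {w : FreeSemigroup A | letters w ∈ L} ∈ FO A := by
  -- The sentence asks for a position with none after it such that the prefix ending there is in
  -- `L`; it exists because words are nonempty.
  have h := (((hL.definable_factor 1 none (some 0)).and
    (((Definable.lt (0 : Fin 2) 1).ex).not)).ex)
  obtain ⟨φ, hφ⟩ := h
  refine ⟨φ, ?_⟩
  ext w
  refine Iff.trans ?_ (hφ (letters w) default).symm
  have hlen : 0 < (letters w).length := Nat.succ_pos _
  have key : ∀ p : Fin (letters w).length, (p : ℕ) + 1 = (letters w).length →
      factor (letters w) 0 (p + 1) = letters w := by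
    intro p hp
    simp [factor, hp]
  simp only [cut, Set.mem_ofPred_eq]
  constructor
  · intro hw
    refine ⟨⟨(letters w).length - 1, by omega⟩, ?_, ?_⟩
    · have := key ⟨(letters w).length - 1, by omega⟩ (Nat.sub_add_cancel hlen)
      simp only [Fin.snoc, Fin.val_zero]
      rwa [← this] at hw
    · rintro ⟨p, hp⟩
      simp [Fin.snoc, Fin.lt_def] at hp
      omega
  · rintro ⟨p, h1, h2⟩
    have hp : (p : ℕ) + 1 = (letters w).length := by
      by_contra hne
      refine h2 ⟨⟨p + 1, by omega⟩, ?_⟩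
      simp [Fin.snoc, Fin.lt_def]
    simpa [Fin.snoc, key p hp] using h1

/-! ### Aperiodic congruences -/

/-- The power `w ^ m` of a word. -/
def listPow {A : Type u} (w : List A) (m : ℕ) : List A := (List.replicate m w).flatten

section

variable {A : Type u}

theorem listPow_succ (w : List A) (m : ℕ) : listPow w (m + 1) = w ++ listPow w m := by
  simp [listPow, List.replicate_succ]

theorem listPow_succ' (w : List A) (m : ℕ) : listPow w (m + 1) = listPow w m ++ w := by
  simp [listPow, List.replicate_succ']

theorem map_listPow {B : Type*} (f : A → B) (w : List A) (m : ℕ) :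
    (listPow w m).map f = listPow (w.map f) m := by
  simp [listPow, List.map_flatten]

theorem mem_listPow {w : List A} {m : ℕ} {a : A} : a ∈ listPow w m ↔ m ≠ 0 ∧ a ∈ w := by
  simp [listPow]

/-- A congruence on words such that the quotient is aperiodic, with a uniform exponent. -/
structure AperiodicCongruence (R : List A → List A → Prop) : Prop where
  refl : ∀ u, R u u
  trans : ∀ {u v w}, R u v → R v w → R u w
  append : ∀ {u u' v v'}, R u u' → R v v' → R (u ++ v) (u' ++ v')
  exists_pow : ∃ N, ∀ m ≥ N, ∀ w, R (listPow w m) (listPow w (m + 1)) ∧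
    R (listPow w (m + 1)) (listPow w m)

theorem aperiodicCongruence_true : AperiodicCongruence (fun _ _ : List A => True) :=
  ⟨fun _ => trivial, fun _ _ => trivial, fun _ _ => trivial, 0, fun _ _ _ => ⟨trivial, trivial⟩⟩

theorem AperiodicCongruence.and {R R' : List A → List A → Prop} (h : AperiodicCongruence R)
    (h' : AperiodicCongruence R') : AperiodicCongruence (fun u v => R u v ∧ R' u v) where
  refl u := ⟨h.refl u, h'.refl u⟩
  trans h1 h2 := ⟨h.trans h1.1 h2.1, h'.trans h1.2 h2.2⟩
  append h1 h2 := ⟨h.append h1.1 h2.1, h'.append h1.2 h2.2⟩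
  exists_pow := by
    obtain ⟨N, hN⟩ := h.exists_pow
    obtain ⟨N', hN'⟩ := h'.exists_pow
    refine ⟨max N N', fun m hm w => ?_⟩
    have h1 := hN m (le_trans (le_max_left _ _) hm) w
    have h2 := hN' m (le_trans (le_max_right _ _) hm) w
    exact ⟨⟨h1.1, h2.1⟩, h1.2, h2.2⟩

theorem aperiodicCongruence_exists_mem (P : A → Prop) :
    AperiodicCongruence (fun u v : List A => (∃ c ∈ u, P c) ↔ ∃ c ∈ v, P c) where
  refl _ := Iff.rfl
  trans := Iff.trans
  append {u u' v v'} h h' := by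
    simp only [List.mem_append, or_and_right, exists_or]
    exact or_congr h h'
  exists_pow := by
    refine ⟨1, fun m hm w => ?_⟩
    have : m ≠ 0 := by omega
    simp [mem_listPow, this]

/-- Two copies of `w` already realize every ordered pair of its letters, so further copies add no
constraint. -/
theorem pairwise_listPow (R : A → A → Prop) (w : List A) (m : ℕ) :
    (listPow w (m + 2)).Pairwise R ↔ w.Pairwise R ∧ ∀ a ∈ w, ∀ b ∈ w, R a b := by
  induction m with
  | zero =>
    rw [listPow_succ, List.pairwise_append, listPow_succ]
    simp [listPow]
  | succ m ih =>
    rw [listPow_succ, List.pairwise_append, ih]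
    simp only [mem_listPow]
    grind

/-- A pair in a concatenation may straddle the two factors; the two occurrence conditions record
what is needed to detect it. -/
theorem aperiodicCongruence_pairwise (P Q : A → Prop) :
    AperiodicCongruence (fun u v : List A =>
      ((∃ c ∈ u, P c) ↔ ∃ c ∈ v, P c) ∧ ((∃ c ∈ u, Q c) ↔ ∃ c ∈ v, Q c) ∧
        (u.Pairwise (fun c d => ¬ (P c ∧ Q d)) ↔ v.Pairwise (fun c d => ¬ (P c ∧ Q d)))) where
  refl _ := ⟨Iff.rfl, Iff.rfl, Iff.rfl⟩
  trans h h' := ⟨h.1.trans h'.1, h.2.1.trans h'.2.1, h.2.2.trans h'.2.2⟩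
  append {u u' v v'} h h' := by
    refine ⟨(aperiodicCongruence_exists_mem P).append h.1 h'.1,
      (aperiodicCongruence_exists_mem Q).append h.2.1 h'.2.1, ?_⟩
    have key : ∀ u v : List A, (∀ c ∈ u, ∀ d ∈ v, ¬ (P c ∧ Q d)) ↔
        ¬ ((∃ c ∈ u, P c) ∧ ∃ d ∈ v, Q d) := by
      intro u v
      grind
    rw [List.pairwise_append, List.pairwise_append, key, key, h.1, h'.2.1, h.2.2, h'.2.2]
  exists_pow := by
    refine ⟨2, fun m hm w => ?_⟩
    obtain ⟨m, rfl⟩ := Nat.exists_eq_add_of_le' hm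
    have : m + 2 + 1 = (m + 1) + 2 := by ring
    rw [this]
    simp only [pairwise_listPow, mem_listPow]
    simp

/-- `u'` is obtained from `u` by relabelling one letter with `g` and the others with `f`. -/
def Marks {B : Type v} (f g : A → B) (u : List A) (u' : List B) : Prop :=
  ∃ p a q, u = p ++ a :: q ∧ u' = p.map f ++ g a :: q.map f

theorem marks_append {B : Type v} {f g : A → B} {u v : List A} {x : List B} :
    Marks f g (u ++ v) x ↔ (∃ u', Marks f g u u' ∧ x = u' ++ v.map f) ∨
      ∃ v', Marks f g v v' ∧ x = u.map f ++ v' := by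
  constructor
  · rintro ⟨p, a, q, h, rfl⟩
    rcases List.append_eq_append_iff.1 h with ⟨r, rfl, rfl⟩ | ⟨r, rfl, h'⟩
    · right
      exact ⟨_, ⟨r, a, q, rfl, rfl⟩, by simp⟩
    · cases r with
      | nil =>
        right
        exact ⟨_, ⟨[], a, q, by simpa using h'.symm, rfl⟩, by simp⟩
      | cons b r =>
        left
        simp only [List.cons_append, List.cons.injEq] at h'
        obtain ⟨rfl, rfl⟩ := h'
        exact ⟨_, ⟨p, a, r, rfl, rfl⟩, by simp⟩
  · rintro (⟨_, ⟨p, a, q, rfl, rfl⟩, rfl⟩ | ⟨_, ⟨p, a, q, rfl, rfl⟩, rfl⟩)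
    · exact ⟨p, a, q ++ v, by simp, by simp⟩
    · exact ⟨u ++ p, a, q, by simp, by simp⟩

theorem marks_listPow {B : Type v} {f g : A → B} {w : List A} {m : ℕ} {x : List B} :
    Marks f g (listPow w m) x ↔ ∃ i j w', i + j + 1 = m ∧ Marks f g w w' ∧
      x = listPow (w.map f) i ++ w' ++ listPow (w.map f) j := by
  induction m generalizing x with
  | zero =>
    constructor
    · rintro ⟨p, a, q, h, -⟩
      simp [listPow] at h
    · rintro ⟨i, j, w', h, -⟩
      omega
  | succ m ih =>
    rw [listPow_succ, marks_append]
    constructor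
    · rintro (⟨w', hw', rfl⟩ | ⟨v', hv', rfl⟩)
      · exact ⟨0, m, w', by omega, hw', by simp [listPow]⟩
      · obtain ⟨i, j, w', h, hw', rfl⟩ := ih.1 hv'
        exact ⟨i + 1, j, w', by omega, hw', by simp [listPow_succ]⟩
    · rintro ⟨i, j, w', h, hw', rfl⟩
      cases i with
      | zero =>
        left
        obtain rfl : j = m := by omega
        exact ⟨w', hw', by simp [listPow]⟩
      | succ i =>
        right
        exact ⟨_, ih.2 ⟨i, j, w', by omega, hw', rfl⟩, by simp [listPow_succ]⟩

/-- The congruence that tests `R` after a relabelling of one letter. -/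
def MarkRel {B : Type v} (f g : A → B) (R : List B → List B → Prop) (u v : List A) : Prop :=
  R (u.map f) (v.map f) ∧ (∀ u', Marks f g u u' → ∃ v', Marks f g v v' ∧ R u' v') ∧
    ∀ v', Marks f g v v' → ∃ u', Marks f g u u' ∧ R u' v'

/-- A mark splits the power into `w ^ i`, a marked copy, and `w ^ j`. As `m ≥ 2 * N + 1`, one side
is long enough for its exponent to change by one within its class: at least `N` to increase it, at
least `N + 1` to decrease it. -/
theorem AperiodicCongruence.exists_marks_listPow {B : Type v} {f g : A → B}
    {R : List B → List B → Prop} (h : AperiodicCongruence R) {N : ℕ}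
    (hN : ∀ m ≥ N, ∀ w, R (listPow w m) (listPow w (m + 1)) ∧
      R (listPow w (m + 1)) (listPow w m)) {m : ℕ} (hm : 2 * N + 1 ≤ m) (w : List A) :
    (∀ x, Marks f g (listPow w m) x → ∃ y, Marks f g (listPow w (m + 1)) y ∧ R x y ∧ R y x) ∧
      ∀ x, Marks f g (listPow w (m + 1)) x → ∃ y, Marks f g (listPow w m) y ∧ R x y ∧ R y x := by
  simp only [marks_listPow]
  constructor
  · rintro _ ⟨i, j, w', hij, hw', rfl⟩
    by_cases hi : N ≤ i
    · obtain ⟨h1, h2⟩ := hN i hi (w.map f)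
      exact ⟨_, ⟨i + 1, j, w', by omega, hw', rfl⟩, h.append (h.append h1 (h.refl _)) (h.refl _),
        h.append (h.append h2 (h.refl _)) (h.refl _)⟩
    · obtain ⟨h1, h2⟩ := hN j (by omega) (w.map f)
      exact ⟨_, ⟨i, j + 1, w', by omega, hw', rfl⟩, h.append (h.refl _) h1,
        h.append (h.refl _) h2⟩
  · rintro _ ⟨i, j, w', hij, hw', rfl⟩
    by_cases hi : N + 1 ≤ i
    · obtain ⟨i, rfl⟩ := Nat.exists_eq_add_of_le' (Nat.one_le_of_lt hi)
      obtain ⟨h1, h2⟩ := hN i (by omega) (w.map f)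
      exact ⟨_, ⟨i, j, w', by omega, hw', rfl⟩, h.append (h.append h2 (h.refl _)) (h.refl _),
        h.append (h.append h1 (h.refl _)) (h.refl _)⟩
    · obtain ⟨j, rfl⟩ := Nat.exists_eq_add_of_le' (show 1 ≤ j by omega)
      obtain ⟨h1, h2⟩ := hN j (by omega) (w.map f)
      exact ⟨_, ⟨i, j, w', by omega, hw', rfl⟩, h.append (h.refl _) h2,
        h.append (h.refl _) h1⟩

/-- This is the quantifier step. The component on unmarked words is needed for concatenation, where
the mark falls in only one of the factors. -/
theorem AperiodicCongruence.markRel {B : Type v} (f g : A → B) {R : List B → List B → Prop}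
    (h : AperiodicCongruence R) : AperiodicCongruence (MarkRel f g R) where
  refl u := ⟨h.refl _, fun u' hu' => ⟨u', hu', h.refl _⟩, fun u' hu' => ⟨u', hu', h.refl _⟩⟩
  trans {u v w} h1 h2 := by
    refine ⟨h.trans h1.1 h2.1, fun x hx => ?_, fun x hx => ?_⟩
    · obtain ⟨y, hy, hxy⟩ := h1.2.1 x hx
      obtain ⟨z, hz, hyz⟩ := h2.2.1 y hy
      exact ⟨z, hz, h.trans hxy hyz⟩
    · obtain ⟨y, hy, hyx⟩ := h2.2.2 x hx
      obtain ⟨z, hz, hzy⟩ := h1.2.2 y hy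
      exact ⟨z, hz, h.trans hzy hyx⟩
  append {u u' v v'} h1 h2 := by
    refine ⟨by simpa using h.append h1.1 h2.1, ?_, ?_⟩
    · intro x hx
      rcases marks_append.1 hx with ⟨y, hy, rfl⟩ | ⟨y, hy, rfl⟩
      · obtain ⟨z, hz, hyz⟩ := h1.2.1 y hy
        exact ⟨_, marks_append.2 (Or.inl ⟨z, hz, rfl⟩), h.append hyz h2.1⟩
      · obtain ⟨z, hz, hyz⟩ := h2.2.1 y hy
        exact ⟨_, marks_append.2 (Or.inr ⟨z, hz, rfl⟩), h.append h1.1 hyz⟩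
    · intro x hx
      rcases marks_append.1 hx with ⟨y, hy, rfl⟩ | ⟨y, hy, rfl⟩
      · obtain ⟨z, hz, hyz⟩ := h1.2.2 y hy
        exact ⟨_, marks_append.2 (Or.inl ⟨z, hz, rfl⟩), h.append hyz h2.1⟩
      · obtain ⟨z, hz, hyz⟩ := h2.2.2 y hy
        exact ⟨_, marks_append.2 (Or.inr ⟨z, hz, rfl⟩), h.append h1.1 hyz⟩
  exists_pow := by
    obtain ⟨N, hN⟩ := h.exists_pow
    refine ⟨2 * N + 1, fun m hm w => ?_⟩
    obtain ⟨h1, h2⟩ := h.exists_marks_listPow (f := f) (g := g) hN hm w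
    obtain ⟨h3, h4⟩ := hN m (by omega) (w.map f)
    simp only [MarkRel, map_listPow]
    refine ⟨⟨h3, fun x hx => ?_, fun x hx => ?_⟩, h4, fun x hx => ?_, fun x hx => ?_⟩
    · obtain ⟨y, hy, hxy, -⟩ := h1 x hx
      exact ⟨y, hy, hxy⟩
    · obtain ⟨y, hy, -, hxy⟩ := h2 x hx
      exact ⟨y, hy, hxy⟩
    · obtain ⟨y, hy, hxy, -⟩ := h2 x hx
      exact ⟨y, hy, hxy⟩
    · obtain ⟨y, hy, -, hxy⟩ := h1 x hx
      exact ⟨y, hy, hxy⟩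

/-! ### First-order languages are saturated by aperiodic congruences -/

/-- The word with distinguished positions, as a word over a larger alphabet. -/
def encode {n : ℕ} (l : List A) (x : Fin n → Fin l.length) : List (A × Set (Fin n)) :=
  List.ofFn fun p : Fin l.length => (l.get p, {i | x i = p})

theorem exists_mem_encode {n : ℕ} {l : List A} {x : Fin n → Fin l.length}
    {P : A × Set (Fin n) → Prop} :
    (∃ c ∈ encode l x, P c) ↔ ∃ p : Fin l.length, P (l.get p, {i | x i = p}) := by
  simp [encode, List.mem_ofFn]

theorem pairwise_encode {n : ℕ} {l : List A} {x : Fin n → Fin l.length}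
    {P : A × Set (Fin n) → A × Set (Fin n) → Prop} :
    (encode l x).Pairwise P ↔ ∀ p q : Fin l.length, p < q →
      P (l.get p, {i | x i = p}) (l.get q, {i | x i = q}) := by
  simp [encode, List.pairwise_ofFn]

/-- The letter `c` without the mark of a new variable. -/
def unmarked {n : ℕ} (c : A × Set (Fin n)) : A × Set (Fin (n + 1)) :=
  (c.1, Fin.castSucc '' c.2)

/-- The letter `c` with the mark of a new variable. -/
def marked {n : ℕ} (c : A × Set (Fin n)) : A × Set (Fin (n + 1)) :=
  (c.1, insert (Fin.last n) (Fin.castSucc '' c.2))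

theorem encode_snoc {n : ℕ} (l : List A) (x : Fin n → Fin l.length) (p : Fin l.length)
    (hp : p < (encode l x).length) :
    encode l (Fin.snoc x p : Fin (n + 1) → Fin l.length) =
      ((encode l x).take p).map unmarked ++
        marked (encode l x)[p] :: ((encode l x).drop (p + 1)).map unmarked := by
  have hset : ∀ q : Fin l.length, {i | (Fin.snoc x p : Fin (n + 1) → Fin l.length) i = q} =
      if q = p then insert (Fin.last n) (Fin.castSucc '' {i | x i = q})
      else Fin.castSucc '' {i | x i = q} := by
    intro q
    ext i
    induction i using Fin.lastCases with
    | last =>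
      by_cases h : q = p
      · simp [h]
      · simp [h, Ne.symm h]
    | cast i =>
      by_cases h : q = p <;> simp [h]
  have hlen : (encode l x).length = l.length := by simp [encode]
  apply List.ext_getElem
  · simp [encode]; omega
  · intro q h1 h2
    have hq : q < l.length := by simpa [encode] using h1
    rw [List.getElem_append]
    simp only [List.length_map, List.length_take, hlen, List.getElem_map, List.getElem_take]
    have hmin : min (p : ℕ) l.length = p := min_eq_left p.2.le
    simp only [hmin]
    rcases lt_trichotomy q p with h | h | h
    · have hne : (⟨q, hq⟩ : Fin l.length) ≠ p := fun h' => by simp [← h'] at h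
      simp [encode, hset, hne, h, unmarked]
    · subst h
      simp [encode, hset, marked]
    · have hne : (⟨q, hq⟩ : Fin l.length) ≠ p := fun h' => by simp [← h'] at h
      obtain ⟨r, rfl⟩ := Nat.exists_eq_add_of_lt h
      have h3 : p + r + 1 - p = r + 1 := by omega
      have h4 : (p : ℕ) + 1 + r = p + r + 1 := by omega
      simp [h3, h4, encode, hset, hne, unmarked]

/-- Choosing a value for a new variable amounts to marking a letter, which links `MarkRel` to
quantification. -/
theorem marks_encode {n : ℕ} {l : List A} {x : Fin n → Fin l.length}
    {y : List (A × Set (Fin (n + 1)))} :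
    Marks unmarked marked (encode l x) y ↔
      ∃ p : Fin l.length, y = encode l (Fin.snoc x p : Fin (n + 1) → Fin l.length) := by
  have hlen : (encode l x).length = l.length := by simp [encode]
  constructor
  · rintro ⟨u, c, v, h, rfl⟩
    have hp : u.length < l.length := by rw [← hlen, h]; simp
    refine ⟨⟨u.length, hp⟩, ?_⟩
    rw [encode_snoc l x ⟨u.length, hp⟩ (by simpa [hlen] using hp)]
    simp [h]
  · rintro ⟨p, rfl⟩
    have hp : p < (encode l x).length := by rw [hlen]; exact p.2
    exact ⟨_, _, _, by simp, encode_snoc l x p hp⟩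

/-- Equality and letter atoms only ask whether some letter of the encoding has a property, and order
atoms whether some pair of letters occurs in order. Implication intersects congruences, and `all`
uses `MarkRel`. -/
theorem exists_aperiodicCongruence {n : ℕ} (φ : (wordLanguage A).BoundedFormula Empty n) :
    ∃ R : List (A × Set (Fin n)) → List (A × Set (Fin n)) → Prop, AperiodicCongruence R ∧
      ∀ (l l' : List A) x x', R (encode l x) (encode l' x') → (Holds φ l x ↔ Holds φ l' x') := by
  have hterm : ∀ {n : ℕ} (t : (wordLanguage A).Term (Empty ⊕ Fin n)),
      ∃ i, t = .var (.inr i) := by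
    intro n t
    rcases t with (i | i) | ⟨f, _⟩
    · exact i.elim
    · exact ⟨i, rfl⟩
    · exact Empty.elim f
  induction φ with
  | falsum => exact ⟨_, aperiodicCongruence_true, fun _ _ _ _ _ => Iff.rfl⟩
  | equal t t' =>
    obtain ⟨i, rfl⟩ := hterm t
    obtain ⟨j, rfl⟩ := hterm t'
    refine ⟨_, aperiodicCongruence_exists_mem fun c => i ∈ c.2 ∧ j ∈ c.2, fun l l' x x' h => ?_⟩
    rw [exists_mem_encode, exists_mem_encode] at h
    simp only [Set.mem_ofPred_eq, exists_eq_left'] at h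
    change x i = x j ↔ x' i = x' j
    rw [eq_comm, h, eq_comm]
  | rel r ts =>
    cases r with
    | letter a =>
      obtain ⟨i, hi⟩ := hterm (ts 0)
      refine ⟨_, aperiodicCongruence_exists_mem fun c => c.1 = a ∧ i ∈ c.2,
        fun l l' x x' h => ?_⟩
      rw [exists_mem_encode, exists_mem_encode] at h
      simp only [Set.mem_ofPred_eq, exists_eq_right'] at h
      have key : ∀ (l : List A) x, Holds (.rel (WordRel.letter a) ts) l x ↔ l.get (x i) = a := by
        intro l x
        let _ := listStructure l
        change l.get ((ts 0).realize _) = a ↔ _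
        rw [hi]
        rfl
      rw [key, key, h]
    | lt =>
      obtain ⟨i, hi⟩ := hterm (ts 0)
      obtain ⟨j, hj⟩ := hterm (ts 1)
      refine ⟨_, aperiodicCongruence_pairwise (fun c => i ∈ c.2) (fun c => j ∈ c.2),
        fun l l' x x' h => ?_⟩
      have h := h.2.2
      rw [pairwise_encode, pairwise_encode] at h
      have key : ∀ (l : List A) x, Holds (.rel WordRel.lt ts) l x ↔ x i < x j := by
        intro l x
        let _ := listStructure l
        change (ts 0).realize _ < (ts 1).realize _ ↔ _
        rw [hi, hj]
        rfl
      rw [key, key]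
      simp only [Set.mem_ofPred_eq] at h
      rw [← not_iff_not]
      refine Iff.trans ⟨?_, ?_⟩ (h.trans ⟨?_, ?_⟩)
      · rintro h p q hpq ⟨rfl, rfl⟩
        exact h hpq
      · exact fun h hij => h _ _ hij ⟨rfl, rfl⟩
      · exact fun h hij => h _ _ hij ⟨rfl, rfl⟩
      · rintro h p q hpq ⟨rfl, rfl⟩
        exact h hpq
  | imp φ ψ ih ih' =>
    obtain ⟨R, hR, h⟩ := ih
    obtain ⟨R', hR', h'⟩ := ih'
    exact ⟨_, hR.and hR', fun l l' x x' hx => imp_congr (h _ _ _ _ hx.1) (h' _ _ _ _ hx.2)⟩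
  | all φ ih =>
    obtain ⟨R, hR, h⟩ := ih
    refine ⟨_, hR.markRel unmarked marked, fun l l' x x' hx => ?_⟩
    have key : ∀ (l : List A) x, Holds φ.all l x ↔ ∀ p, Holds φ l (Fin.snoc x p) :=
      fun _ _ => Iff.rfl
    rw [key, key]
    obtain ⟨-, h1, h2⟩ := hx
    constructor
    · intro hall p
      obtain ⟨u, hu, hR⟩ := h2 _ (marks_encode.2 ⟨p, rfl⟩)
      obtain ⟨q, rfl⟩ := marks_encode.1 hu
      exact (h _ _ _ _ hR).1 (hall q)
    · intro hall p
      obtain ⟨u, hu, hR⟩ := h1 _ (marks_encode.2 ⟨p, rfl⟩)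
      obtain ⟨q, rfl⟩ := marks_encode.1 hu
      exact (h _ _ _ _ hR).2 (hall q)

theorem AperiodicCongruence.comap {B : Type v} (f : A → B) {R : List B → List B → Prop}
    (h : AperiodicCongruence R) : AperiodicCongruence (fun u v => R (u.map f) (v.map f)) where
  refl u := h.refl _
  trans := h.trans
  append h1 h2 := by simpa using h.append h1 h2
  exists_pow := by
    obtain ⟨N, hN⟩ := h.exists_pow
    exact ⟨N, fun m hm w => by simpa [map_listPow] using hN m hm (w.map f)⟩

/-- Every first-order language is saturated by an aperiodic congruence. -/
theorem exists_aperiodicCongruence_of_mem_FO {L : Set (FreeSemigroup A)} (hL : L ∈ FO A) :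
    ∃ R : List A → List A → Prop, AperiodicCongruence R ∧
      ∀ w w', R (letters w) (letters w') → (w ∈ L ↔ w' ∈ L) := by
  obtain ⟨φ, rfl⟩ := hL
  obtain ⟨R, hR, h⟩ := exists_aperiodicCongruence φ
  refine ⟨_, hR.comap fun a => (a, ∅), fun w w' hw => ?_⟩
  have key : ∀ l : List A, l.map (fun a => (a, ∅)) =
      encode l (default : Fin 0 → Fin l.length) := by
    intro l
    apply List.ext_getElem
    · simp [encode]
    · intro i h1 h2
      simp [encode, Set.eq_empty_of_isEmpty]
  rw [key, key] at hw
  exact h _ _ _ _ hw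

theorem exists_aperiodicCongruence_of_finite {K : Set (Set (FreeSemigroup A))} (hK : K.Finite)
    (hFO : K ⊆ FO A) :
    ∃ R : List A → List A → Prop, AperiodicCongruence R ∧
      ∀ L ∈ K, ∀ w w', R (letters w) (letters w') → (w ∈ L ↔ w' ∈ L) := by
  induction K, hK using Set.Finite.induction_on with
  | empty => exact ⟨_, aperiodicCongruence_true, by simp⟩
  | @insert L K _ _ ih =>
    obtain ⟨R, hR, h⟩ := ih fun L' hL' => hFO (Set.mem_insert_of_mem _ hL')
    obtain ⟨R', hR', h'⟩ := exists_aperiodicCongruence_of_mem_FO (hFO (Set.mem_insert _ _))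
    refine ⟨_, hR.and hR', ?_⟩
    rintro L' (rfl | hL') w w' hw
    · exact h' w w' hw.2
    · exact h L' hL' w w' hw.1

end

/-! ### Soundness of saturation -/

section

variable {A : Type u} {S : Type v} [Semigroup S]

theorem letters_mul (w w' : FreeSemigroup A) : letters (w * w') = letters w ++ letters w' := by
  simp [letters]

theorem letters_spow (w : FreeSemigroup A) (n : ℕ+) :
    letters (spow w n) = listPow (letters w) n := by
  induction n using PNat.recOn with
  | one => simp [spow_one, listPow]
  | succ n ih => rw [spow_succ, letters_mul, ih, PNat.add_coe, PNat.one_coe, listPow_succ']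

open scoped Pointwise

/-- All elements of `T` are images of words in the `R`-class of `w`. -/
def CoveredBy (α : FreeSemigroup A →ₙ* S) (R : List A → List A → Prop) (T : Set S)
    (w : FreeSemigroup A) : Prop :=
  ∀ t ∈ T, ∃ w', R (letters w) (letters w') ∧ α w' = t

variable {α : FreeSemigroup A →ₙ* S} {R : List A → List A → Prop}

theorem CoveredBy.mul (hR : AperiodicCongruence R) {T T' : Set S} {w w' : FreeSemigroup A}
    (h : CoveredBy α R T w) (h' : CoveredBy α R T' w') : CoveredBy α R (T * T') (w * w') := by
  rintro _ ⟨t, ht, t', ht', rfl⟩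
  obtain ⟨v, hv, rfl⟩ := h t ht
  obtain ⟨v', hv', rfl⟩ := h' t' ht'
  exact ⟨v * v', by simpa only [letters_mul] using hR.append hv hv', map_mul α v v'⟩

theorem CoveredBy.spow (hR : AperiodicCongruence R) {T : Set S} {w : FreeSemigroup A}
    (h : CoveredBy α R T w) (n : ℕ+) : CoveredBy α R (spow T n) (spow w n) := by
  induction n using PNat.recOn with
  | one => simpa only [spow_one] using h
  | succ n ih => simpa only [spow_succ] using ih.mul hR h

theorem spow_mul_of_isIdempotentElem {M : Type v} [Semigroup M] {s : M} {m : ℕ+}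
    (hm : IsIdempotentElem (FOImprint.spow s m)) (k : ℕ+) :
    FOImprint.spow s (k * m) = FOImprint.spow s m := by
  induction k using PNat.recOn with
  | one => rw [one_mul]
  | succ k ih => rw [add_mul, one_mul, spow_add, ih, hm]

/-- By minimality of the saturation, it suffices that the sets covered by some word form a saturated
family containing the singletons. -/
theorem exists_coveredBy [Finite S] (hR : AperiodicCongruence R) {T : Set S} (hT : T ∈ SatHom α) :
    ∃ w, CoveredBy α R T w := by
  suffices h : SatHom α ⊆ {T | ∃ w, CoveredBy α R T w} from h hT
  refine (isLeast_Sat _).2 ⟨?_, ?_, ?_, ?_⟩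
  · rintro _ ⟨w, rfl⟩
    refine ⟨w, ?_⟩
    rintro _ rfl
    exact ⟨w, hR.refl _, rfl⟩
  · refine Set.Subset.antisymm (fun T hT => ⟨T, hT, subset_rfl⟩) ?_
    rintro T ⟨T', ⟨w, hw⟩, hTT'⟩
    exact ⟨w, fun t ht => hw t (hTT' ht)⟩
  · rintro T ⟨w, hw⟩ T' ⟨w', hw'⟩
    exact ⟨w * w', hw.mul hR hw'⟩
  · rintro T ⟨w, hw⟩
    obtain ⟨N, hN⟩ := hR.exists_pow
    set ω := omega (Set S)
    have hω : IsIdempotentElem (FOImprint.spow T ω) := isIdempotentElem_spow_omega T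
    -- A multiple of `ω` keeps `T ^ m = T ^ ω`, and being at least `N` makes `w ^ m` congruent to `w
    -- ^ (m + 1)`.
    let m : ℕ+ := N.succPNat * ω
    have hm : N ≤ m := by
      have h1 : 1 ≤ (ω : ℕ) := ω.2
      have : (m : ℕ) = (N + 1) * ω := rfl
      nlinarith
    have hTm : FOImprint.spow T m = FOImprint.spow T ω := spow_mul_of_isIdempotentElem hω _
    refine ⟨FOImprint.spow w m, ?_⟩
    rintro t (ht | ht)
    · rw [← hTm] at ht
      exact hw.spow hR m t ht
    · rw [spow_succ, ← hTm, ← spow_succ] at ht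
      obtain ⟨w', h1, h2⟩ := hw.spow hR (m + 1) t ht
      refine ⟨w', hR.trans ?_ h1, h2⟩
      rw [letters_spow, letters_spow, PNat.add_coe, PNat.one_coe]
      exact (hN m hm _).1

end

open scoped Pointwise

/-! ### The ordered monoid of a saturated set -/

section

variable {A : Type u} {S : Type v} [Semigroup S]

theorem image_coe_spow (T : Set S) (n : ℕ+) :
    ((↑) : S → WithOne S) '' spow T n = (((↑) : S → WithOne S) '' T) ^ (n : ℕ) := by
  induction n using PNat.recOn with
  | one => rw [spow_one, PNat.one_coe, pow_one]
  | succ n ih =>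
    rw [spow_succ, PNat.add_coe, PNat.one_coe, pow_succ, ← ih]
    exact Set.image_mul (WithOne.coeMulHom (α := S))

variable [Finite S]

/-- The set `{1}` and the elements of a saturated set, as subsets of the monoid `S¹`. -/
def IsSaturated.submonoid {𝒯 : Set (Set S)} (h : IsSaturated 𝒯) : Submonoid (Set (WithOne S)) where
  carrier := {T | T = 1 ∨ ∃ T' ∈ 𝒯, T = (↑) '' T'}
  one_mem' := Or.inl rfl
  mul_mem' := by
    rintro T U (rfl | ⟨T, hT, rfl⟩) (rfl | ⟨U, hU, rfl⟩)
    · exact Or.inl (one_mul 1)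
    · exact Or.inr ⟨U, hU, one_mul _⟩
    · exact Or.inr ⟨T, hT, mul_one _⟩
    · exact Or.inr ⟨T * U, h.mul_mem T hT U hU,
        (Set.image_mul (WithOne.coeMulHom (α := S))).symm⟩

theorem IsSaturated.sharp_mem {𝒯 : Set (Set S)} (h : IsSaturated 𝒯) {T : Set (WithOne S)}
    (hT : T ∈ h.submonoid) :
    T ^ (omega (Set S) : ℕ) ∪ T ^ ((omega (Set S) : ℕ) + 1) ∈ h.submonoid := by
  rcases hT with rfl | ⟨T, hT, rfl⟩
  · left
    rw [one_pow, one_pow, Set.union_self]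
  · right
    refine ⟨_, h.fo_mem T hT, ?_⟩
    rw [Set.image_union, image_coe_spow, image_coe_spow, PNat.add_coe, PNat.one_coe]

/-- Conjugation holds since `T U = U V` gives `T ^ n U = U V ^ n` for every `n`, and products
distribute over unions. -/
instance IsSaturated.sharpMonoid {𝒯 : Set (Set S)} (h : IsSaturated 𝒯) :
    SharpMonoid h.submonoid where
  __ := (inferInstance : Monoid h.submonoid)
  __ := (inferInstance : Preorder h.submonoid)
  mul_le_mul h1 h2 := Set.mul_subset_mul h1 h2
  sharp T := ⟨_, h.sharp_mem T.2⟩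
  exists_pow_le_sharp _ := ⟨_, Set.subset_union_left, Set.subset_union_right⟩
  sharp_mul {T U V} hTV := by
    have hc : SemiconjBy U.1 V.1 T.1 := (congrArg Subtype.val hTV).symm
    apply Subtype.ext
    change (_ ∪ _) * U.1 = U.1 * (_ ∪ _)
    rw [Set.union_mul, Set.mul_union, (hc.pow_right _).eq, (hc.pow_right _).eq]

/-! ### The optimal imprint -/

variable (α : FreeSemigroup A →ₙ* S)

theorem isSaturated_SatHom : IsSaturated (SatHom α) := (isLeast_Sat _).1.2

theorem singleton_mem_SatHom (w : FreeSemigroup A) : {α w} ∈ SatHom α :=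
  (isLeast_Sat _).1.1 ⟨w, rfl⟩

/-- The map `a ↦ {α a}` into the monoid of the saturation. -/
def letterValue (a : A) : (isSaturated_SatHom α).submonoid :=
  ⟨{(α (FreeSemigroup.of a) : WithOne S)}, Or.inr ⟨_, singleton_mem_SatHom α (FreeSemigroup.of a), by simp⟩⟩

theorem wordValue_letters (w : FreeSemigroup A) :
    (wordValue (letterValue α) (letters w)).1 = {(α w : WithOne S)} := by
  induction w using FreeSemigroup.recOnMul with
  | ih1 a => simp [letters, wordValue, letterValue]
  | ih2 a w h1 h2 =>
    rw [letters_mul, wordValue_append, Submonoid.coe_mul, h1, h2, map_mul, WithOne.coe_mul,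
      Set.singleton_mul_singleton]

/-- A first-order partition whose imprint is contained in the saturation. -/
theorem exists_partition_imprint_subset [Finite A] :
    ∃ K, IsPartitionIn (FO A) K ∧ imprint α K ⊆ SatHom α := by
  have : Finite (WithOne S) := inferInstanceAs (Finite (Option S))
  have : Finite (isSaturated_SatHom α).submonoid := Subtype.finite
  obtain ⟨ι, _, f, V, hf, hV⟩ := hasBoundedClassification _ rfl A (letterValue α)
  let r : Setoid (FreeSemigroup A) := Setoid.ker fun w => f (letters w)
  have hr : ∀ w, {w' | r w' w} = {w' | letters w' ∈ f ⁻¹' {f (letters w)}} := fun w => rfl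
  refine ⟨r.classes, ⟨?_, Setoid.isPartition_classes r, ?_⟩, ?_⟩
  · refine (Set.finite_range fun i => {w' : FreeSemigroup A | f (letters w') = i}).subset ?_
    rintro _ ⟨w, rfl⟩
    exact ⟨f (letters w), rfl⟩
  · rintro _ ⟨w, rfl⟩
    rw [hr]
    exact (hf _).letters_preimage_mem_FO
  · rintro T ⟨_, ⟨w, rfl⟩, hT⟩
    have hle : ∀ w', r w' w → (α w' : WithOne S) ∈ (V (f (letters w))).1 := by
      intro w' hw'
      have hw : f (letters w') = f (letters w) := hw'
      have := hV (letters w') trivial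
      rw [hw] at this
      have h' : (wordValue (letterValue α) (letters w')).1 ⊆ (V (f (letters w))).1 := this
      rw [wordValue_letters] at h'
      exact Set.singleton_subset_iff.1 h'
    -- The bound cannot be `{1}`, because it contains `α w`, which differs from the adjoined unit.
    -- So it comes from a member of the saturation.
    rcases (V (f (letters w))).2 with h1 | ⟨U, hU, h1⟩
    · have := hle w rfl
      rw [h1, Set.mem_one] at this
      exact absurd this WithOne.coe_ne_one
    · rw [(isSaturated_SatHom α).downset_eq]
      refine ⟨U, hU, fun t ht => ?_⟩
      obtain ⟨w', hw', rfl⟩ := hT ht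
      have := hle w' hw'
      rw [h1] at this
      obtain ⟨s, hs, hs'⟩ := this
      rwa [← WithOne.coe_inj.1 hs']

/-- The block containing the covering word also contains every word congruent to it, hence a
preimage of each element of `T`. -/
theorem SatHom_subset_imprint {K : Set (Set (FreeSemigroup A))} (hK : IsPartitionIn (FO A) K) :
    SatHom α ⊆ imprint α K := by
  intro T hT
  obtain ⟨R, hR, h⟩ := exists_aperiodicCongruence_of_finite hK.finite hK.subset
  obtain ⟨w, hw⟩ := exists_coveredBy hR hT
  obtain ⟨L, ⟨hL, hwL⟩, -⟩ := hK.isPartition.2 w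
  refine ⟨L, hL, fun t ht => ?_⟩
  obtain ⟨w', hw', rfl⟩ := hw t ht
  exact ⟨w', (h L hL w w' hw').1 hwL, rfl⟩

end

end FOImprint

theorem mainTheorem2 {A : Type*} [Finite A] {S : Type*} [Semigroup S] [Finite S]
    (α : FreeSemigroup A →ₙ* S) :
    (∃ K, FOImprint.IsOptimal (FOImprint.FO A) α K) ∧
      FOImprint.optimalImprint (FOImprint.FO A) α = FOImprint.SatHom α := by
  obtain ⟨K, hK, hsub⟩ := FOImprint.exists_partition_imprint_subset α
  have hopt : FOImprint.IsOptimal (FOImprint.FO A) α K :=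
    ⟨hK, fun K' hK' => hsub.trans (FOImprint.SatHom_subset_imprint α hK')⟩
  refine ⟨⟨K, hopt⟩, ?_⟩
  rw [FOImprint.optimalImprint_eq hopt]
  exact hsub.antisymm (FOImprint.SatHom_subset_imprint α hK)
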